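/- Let $n\ge 1$ and let $A\subset(\mathbb{Z}_{\ge 0})^{n+1}$ be a finite set that is integral, i.e. (1) $A$ contains a point of each coordinate hyperplane $x_j=0$; (2) $0\notin A$; (3) either $\dim A\ge 2$, or $\dim A=1$ and $\operatorname{conv}(A)$ contains exactly two integral points, where $\dim A$ is the dimension of the $\mathbb{Q}$-span of $A-I$ for any $I\in A$. For $a=(a_I)_{I\in A}\in(\mathbb{C}^*)^{A}$ let $f=\sum_{I\in A}a_Ix^{I}\in\mathbb{C}[x_1,\dots,x_{n+1}]$ and let $X=V(f)\subset\mathbb{A}^{n+1}$. Let $F(A)\subset(\mathbb{C}^*)^A$ be the set of those $a$ for which $f$ generates a prime ideal in $\mathbb{C}[x_1^{\pm1},\dots,x_{n+1}^{\pm1}]$. Let $\alpha=(\alpha_1,\dots,\alpha_{n+1})$ be a tuple of positive integers, write $\alpha\cdot I=\sum_j\alpha_jI_j$, and call $\alpha$ feasible if $\min_{I\in A}\alpha\cdot I$ is attained by at least two different $I\in A$. Let $P_0$ be the sum of the terms $a_Ix^I$ of $f$ for which $\alpha\cdot I$ is minimal, and let $F_\alpha\subset(\mathbb{C}^*)^A$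 be the set of those $a$ for which $P_0,\partial P_0/\partial x_1,\dots,\partial P_0/\partial x_{n+1}$ have no common zero in $(\mathbb{C}^*)^{n+1}$. For $m\geq\max_j\alpha_j$, let $C^m_\alpha$ be the set of $m$-jets of $X$ that are truncations of arcs $\gamma$ of $X$ with $\gamma(0)=0$ (an arc being a tuple in $\mathbb{C}[[t]]^{n+1}$ annihilating $f$) and whose order along $x_j$ is exactly $\alpha_j$ for every $j$. It is a subset of the affine space $\mathbb{C}^{(n+1)(m+1)}$ of $m$-jets of $\mathbb{A}^{n+1}$, and its dimension is that of its Zariski closure. Then: (i) If $\alpha$ is not feasible, then $C^m_\alpha=\emptyset$ for all $a\in(\mathbb{C}^*)^A$ and all $m\ge\max_j\alpha_j$. (ii) If $\alpha$ is feasible and $a\in F_\alpha\cap F(A)$, then for all sufficiently large $m$ the right-hand side below is a nonnegative integer and $$\dim C^m_\alpha\le mn-\sum_{j=1}^{n+1}(\alpha_j-1)-1+\min_{I\in A}\alpha\cdot I-\min_{\substack{I\in A,\ 1\le j\le n+1\\ I_j>0}}(\alpha\cdot I-\alpha_j).$$ -/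

import Mathlib

noncomputable section

namespace HypersurfaceJets

/-! ### Supports, polynomials with a given support, and generality conditions -/

/-- A finite set of multi-indices in `(ℤ_{≥0})^{n+1}`. -/
abbrev Support (n : ℕ) := Finset (Fin (n + 1) →₀ ℕ)

/-- The product `α · I = ∑ j, α_j I_j`. -/
def dot {n : ℕ} (α : Fin (n + 1) → ℕ) (I : Fin (n + 1) →₀ ℕ) : ℕ :=
  ∑ j, α j * I j

/-- The dimension of `A`: the dimension of the `ℚ`-span of the differences of points of `A`. -/
def supportDim {n : ℕ} (A : Support n) : ℕ :=
  Module.finrank ℚ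
    (vectorSpan ℚ ((fun (I : Fin (n + 1) →₀ ℕ) (j : Fin (n + 1)) => (I j : ℚ)) '' (A : Set _)))

/-- The integral points of the convex hull of `A`. -/
def convIntegralPoints {n : ℕ} (A : Support n) : Set (Fin (n + 1) → ℤ) :=
  {z | (fun j => (z j : ℝ)) ∈
    convexHull ℝ ((fun (I : Fin (n + 1) →₀ ℕ) (j : Fin (n + 1)) => (I j : ℝ)) '' (A : Set _))}

/-- Integral subsets of `(ℤ_{≥0})^{n+1}`. -/
structure IsIntegralSupport {n : ℕ} (A : Support n) : Prop where
  meets_coordinate_planes : ∀ j : Fin (n + 1), ∃ I ∈ A, I j = 0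
  zero_notMem : (0 : Fin (n + 1) →₀ ℕ) ∉ A
  dim_cond : 2 ≤ supportDim A ∨ (supportDim A = 1 ∧ (convIntegralPoints A).ncard = 2)

/-- The polynomial `f = ∑_{I ∈ A} a_I x^I`, for a family `a ∈ (ℂ^*)^A`. -/
def poly {n : ℕ} (A : Support n) (a : A → ℂˣ) : MvPolynomial (Fin (n + 1)) ℂ :=
  ∑ I : A, MvPolynomial.monomial I.1 (a I : ℂ)

/-- The same polynomial in the Laurent polynomial ring `ℂ[x_1^{±1}, …, x_{n+1}^{±1}]`, that is,
the group algebra of `ℤ^{n+1}`. -/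
def laurentPoly {n : ℕ} (A : Support n) (a : A → ℂˣ) :
    AddMonoidAlgebra ℂ (Fin (n + 1) → ℤ) :=
  ∑ I : A, AddMonoidAlgebra.single (fun j => (I.1 j : ℤ)) (a I : ℂ)

/-- `F(A)`: the coefficients for which `f` generates a prime ideal in the Laurent polynomial
ring. -/
def primeCoeffs {n : ℕ} (A : Support n) : Set (A → ℂˣ) :=
  {a | (Ideal.span {laurentPoly A a}).IsPrime}

/-- `min_{I ∈ A} α · I`. -/
def minWeight {n : ℕ} (A : Support n) (α : Fin (n + 1) → ℕ) : ℕ :=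
  sInf {k | ∃ I ∈ A, k = dot α I}

/-- `min (I · α - α_j)`, over all `I ∈ A` and all `j` with `I_j > 0`. -/
def minShiftedWeight {n : ℕ} (A : Support n) (α : Fin (n + 1) → ℕ) : ℤ :=
  sInf {k | ∃ I ∈ A, ∃ j : Fin (n + 1), 0 < I j ∧ k = (dot α I : ℤ) - (α j : ℤ)}

/-- `α` is feasible if `min_{I ∈ A} α · I` is attained by at least two different `I`. -/
def Feasible {n : ℕ} (A : Support n) (α : Fin (n + 1) → ℕ) : Prop :=
  ∃ I ∈ A, ∃ J ∈ A, I ≠ J ∧ dot α I = minWeight A α ∧ dot α J = minWeight A α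

/-- The polynomial `P_0`: the sum of the terms `a_I x^I` of `f` for which `α · I` is minimal. -/
def initialPoly {n : ℕ} (A : Support n) (a : A → ℂˣ) (α : Fin (n + 1) → ℕ) :
    MvPolynomial (Fin (n + 1)) ℂ :=
  ∑ I : A with dot α I.1 = minWeight A α, MvPolynomial.monomial I.1 (a I : ℂ)

/-- `F_α`: the coefficients for which `P_0` and all its partial derivatives have no common zero
in the torus `(ℂ^*)^{n+1}`. -/
def smoothCoeffs {n : ℕ} (A : Support n) (α : Fin (n + 1) → ℕ) : Set (A → ℂˣ) :=
  {a | ∀ y : Fin (n + 1) → ℂ, (∀ j, y j ≠ 0) →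
    ¬ (MvPolynomial.eval y (initialPoly A a α) = 0 ∧
      ∀ j, MvPolynomial.eval y (MvPolynomial.pderiv j (initialPoly A a α)) = 0)}

/-! ### Arcs, jets and contact loci of the hypersurface `X = V(f)` in `𝔸^{n+1}`

An arc is given by the power series `γ^*(x_j)`; an `m`-jet is given by the coefficients
`x_j^{(s)}`, `0 ≤ s ≤ m`, of the truncated power series `γ^*(x_j) ∈ ℂ[t]/(t^{m+1})`. -/

/-- `X_∞`: the arcs of the hypersurface `f = 0`. -/
def arcs {n : ℕ} (f : MvPolynomial (Fin (n + 1)) ℂ) : Set (Fin (n + 1) → PowerSeries ℂ) :=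
  {γ | MvPolynomial.aeval γ f = 0}

/-- `m`-jets of `𝔸^{n+1}`: the affine space with coordinates `x_j^{(s)}`, `0 ≤ s ≤ m`. -/
abbrev Jet (n m : ℕ) := Fin (n + 1) × Fin (m + 1) → ℂ

/-- The truncated power series `∑_{s ≤ m} x_j^{(s)} t^s` of a jet. -/
def jetSeries {n m : ℕ} (p : Jet n m) (j : Fin (n + 1)) : PowerSeries ℂ :=
  PowerSeries.mk fun s => if h : s < m + 1 then p (j, ⟨s, h⟩) else 0

/-- `X_m`: the `m`-jets of the hypersurface `f = 0`, i.e. `f` vanishes modulo `t^{m+1}`. -/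
def jets {n : ℕ} (f : MvPolynomial (Fin (n + 1)) ℂ) (m : ℕ) : Set (Jet n m) :=
  {p | (PowerSeries.X : PowerSeries ℂ) ^ (m + 1) ∣ MvPolynomial.aeval (jetSeries p) f}

/-- The truncation map `ψ_m`. -/
def truncate {n : ℕ} (m : ℕ) (γ : Fin (n + 1) → PowerSeries ℂ) : Jet n m :=
  fun q => PowerSeries.coeff (q.2 : ℕ) (γ q.1)

/-- `C^m = ψ_m(π⁻¹(0))`: the `m`-jets that lift to an arc of the hypersurface centered at the
origin. -/
def originJets {n : ℕ} (f : MvPolynomial (Fin (n + 1)) ℂ) (m : ℕ) : Set (Jet n m) :=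
  truncate m '' {γ ∈ arcs f | ∀ j, PowerSeries.constantCoeff (γ j) = 0}

/-- `Cont^e(x_j)_m`: the `m`-jets of the hypersurface with order exactly `e` along `x_j`
(used for `e ≤ m`). -/
def contactJets {n : ℕ} (f : MvPolynomial (Fin (n + 1)) ℂ) (m : ℕ) (j : Fin (n + 1)) (e : ℕ) :
    Set (Jet n m) :=
  {p ∈ jets f m | (jetSeries p j).order = e}

/-- `C^m_α = C^m ∩ ⋂_j Cont^{α_j}(x_j)_m`. -/
def contactLocus {n : ℕ} (f : MvPolynomial (Fin (n + 1)) ℂ) (m : ℕ) (α : Fin (n + 1) → ℕ) :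
    Set (Jet n m) :=
  originJets f m ∩ ⋂ j, contactJets f m j (α j)

/-- The dimension of a subset of an affine space `ℂ^σ`: the dimension of its Zariski closure,
i.e. the Krull dimension of the coordinate ring of the closure. It is `⊥` for the empty set. -/
def zariskiDim {σ : Type} (S : Set (σ → ℂ)) : WithBot ℕ∞ :=
  ringKrullDim (MvPolynomial σ ℂ ⧸ MvPolynomial.vanishingIdeal ℂ S)

end HypersurfaceJets

end

/-! Substitute `x_j = t^{α_j} y_j`: then `f = t^w g(y)` with `w = min α·I`, and `g` reduces to `P_0`
modulo `t`. An arc in the contact locus gives `g(y) = 0` with `y(0)` in the torus, so `P_0(y(0)) =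
0`. Without feasibility `P_0` is a monomial and this is impossible.

Otherwise, let `μ` be the minimum of `α·I - α_j`. The jet determines `y_j` modulo `t^{m+1-α_j}`, and
changing `y` within that precision changes `g(y)` only by multiples of `t^N`, where `N = m+1+μ-w`.
Liftability to an arc thus imposes `N` equations on the jet, `μ` more than `f ≡ 0` modulo `t^{m+1}`
shows directly. On each component of the closure some `∂P_0/∂x_i` is not identically zero at `y(0)`.
Newton iteration then makes the first `N` coefficients of `y_i` algebraic over the remaining
coordinates (`coeff_mem_of_X_pow_dvd_eval₂`). Transcendence degree, hence dimension, is at most `∑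
(m+1-α_j) - N`, which is the bound. -/

/-! ### Krull dimension and transcendence degree -/

-- Noether normalization makes `D` integral over a polynomial ring in `s ≤ d` variables, and
-- incomparability bounds its dimension by `s`.
open MvPolynomial in
theorem ringKrullDim_le_of_trdeg_le {k D : Type} [Field k] [CommRing D] [IsDomain D] [Algebra k D]
    [Algebra.FiniteType k D] {d : ℕ} (h : Algebra.trdeg k D ≤ d) : ringKrullDim D ≤ d := by
  obtain ⟨s, g, hinj, hint⟩ := exists_integral_inj_algHom_of_fg k D
  algebraize [g.toRingHom]
  have : Algebra.IsIntegral (MvPolynomial (Fin s) k) D := ⟨hint⟩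
  have h1 : ringKrullDim D ≤ ringKrullDim (MvPolynomial (Fin s) k) :=
    Order.krullDim_le_of_strictMono
      (PrimeSpectrum.comap (algebraMap (MvPolynomial (Fin s) k) D)) fun I J hIJ =>
        Ideal.IsIntegral.comap_lt_comap (R := MvPolynomial (Fin s) k) (I := I.asIdeal)
          (J := J.asIdeal) hIJ
  have h2 : (s : Cardinal) ≤ d := by
    have := (trdeg_le_of_injective g hinj).trans h
    rwa [MvPolynomial.trdeg_of_isDomain, Cardinal.mk_fin, Cardinal.lift_natCast] at this
  rw [MvPolynomial.ringKrullDim_of_isNoetherianRing, ringKrullDim_eq_zero_of_field] at h1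
  simp only [Nat.card_eq_fintype_card, Fintype.card_fin, zero_add] at h1
  exact h1.trans (by exact_mod_cast h2)

theorem ringKrullDim_quotient_le_of_minimalPrimes {R : Type*} [CommRing R] {I : Ideal R}
    {d : WithBot ℕ∞} (h : ∀ p ∈ I.minimalPrimes, ringKrullDim (R ⧸ p) ≤ d) :
    ringKrullDim (R ⧸ I) ≤ d := by
  rw [ringKrullDim_quotient, Order.krullDim]
  refine iSup_le fun c => ?_
  obtain ⟨p, hp, hle⟩ := Ideal.exists_minimalPrimes_le (J := (c.head).1.asIdeal) c.head.2
  refine le_trans ?_ (h p hp)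
  rw [ringKrullDim_quotient]
  have hmem : ∀ i, (c i).1 ∈ PrimeSpectrum.zeroLocus (p : Set R) := fun i =>
    hle.trans (c.monotone (Fin.zero_le i))
  exact le_iSup_of_le (LTSeries.mk c.length (fun i => ⟨(c i).1, hmem i⟩)
    fun i j hij => c.strictMono hij) le_rfl

/-- Elements of a field that are algebraic over `L` lie in `L`. -/
def IsAlgClosedIn (L K : Type*) [Field L] [Field K] [Algebra L K] : Prop :=
  ∀ x : K, IsAlgebraic L x → x ∈ (algebraMap L K).range

-- Apply the hypothesis to the relative algebraic closure of `k(T)` in `K`. Quantifying over `L`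
-- lets applications argue by mere membership, with no algebraic relations to exhibit.
open scoped IntermediateField.algebraAdjoinAdjoin in
theorem trdeg_le_card_of_generators {k D K σ : Type} [Field k] [CommRing D] [IsDomain D]
    [Algebra k D] [Field K] [Algebra D K] [IsFractionRing D K] [Algebra k K] [IsScalarTower k D K]
    (x : σ → D) (hx : Algebra.adjoin k (Set.range x) = ⊤) (T : Finset σ)
    (h : ∀ L : IntermediateField k K, IsAlgClosedIn L K →
      (∀ i ∈ T, algebraMap D K (x i) ∈ L) → ∀ i, algebraMap D K (x i) ∈ L) :
    Algebra.trdeg k D ≤ T.card := by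
  classical
  set s : Set K := (fun i => algebraMap D K (x i)) '' (T : Set σ) with hs
  set F := IntermediateField.adjoin k s
  set L : IntermediateField k K := (algebraicClosure F K).restrictScalars k with hL
  have hclosed : IsAlgClosedIn L K := by
    intro y hy
    have hy' : IsAlgebraic (algebraicClosure F K) y := hy
    exact ⟨⟨y, (IntermediateField.mem_restrictScalars k).2
      (mem_algebraicClosure_iff.2 (hy'.restrictScalars F))⟩, rfl⟩
  have hmem := h L hclosed fun i hi => (IntermediateField.mem_restrictScalars k).2 <|
    (algebraicClosure F K).algebraMap_mem
      (⟨_, IntermediateField.subset_adjoin k s ⟨i, hi, rfl⟩⟩ : F)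
  have hD : ∀ y : D, algebraMap D K y ∈ L := by
    intro y
    have : (⊤ : Subalgebra k D) ≤ L.toSubalgebra.comap (IsScalarTower.toAlgHom k D K) := by
      rw [← hx, Algebra.adjoin_le_iff]
      rintro _ ⟨i, rfl⟩
      exact hmem i
    exact this (Algebra.mem_top (x := y))
  have halg : Algebra.IsAlgebraic F K := ⟨fun y => by
    obtain ⟨a, b, -, rfl⟩ := IsFractionRing.div_surjective (A := D) y
    exact mem_algebraicClosure_iff.1 (L.div_mem (hD a) (hD b))⟩
  have : Algebra.IsAlgebraic (Algebra.adjoin k s) K :=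
    (IsFractionRing.comap_isAlgebraic_iff (A := Algebra.adjoin k s) (K := F)).2 halg
  calc Algebra.trdeg k D ≤ Algebra.trdeg k K :=
        trdeg_le_of_injective (IsScalarTower.toAlgHom k D K) (IsFractionRing.injective D K)
    _ ≤ Cardinal.mk s := Algebra.IsAlgebraic.trdeg_le_cardinalMk k s
    _ ≤ Cardinal.mk (T : Set σ) := Cardinal.mk_image_le
    _ = T.card := by simp

/-! ### Newton iteration over a relatively algebraically closed subfield -/

open Polynomial in
/-- A power series root of a polynomial over `L⟦X⟧` at which the derivative is invertible has
coefficients in `L`, if `L` is algebraically closed in `K`. -/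
theorem PowerSeries.coeff_mem_range_of_X_pow_dvd_eval₂ {L K : Type*} [Field L] [Field K]
    [Algebra L K] (hL : IsAlgClosedIn L K) (Φ : Polynomial (PowerSeries L))
    (z : PowerSeries K) (N : ℕ)
    (h : (X : PowerSeries K) ^ N ∣ Φ.eval₂ (PowerSeries.map (algebraMap L K)) z)
    (hd : constantCoeff (Φ.derivative.eval₂ (PowerSeries.map (algebraMap L K)) z) ≠ 0) :
    ∀ s < N, coeff s z ∈ (algebraMap L K).range := by
  have hcc : ∀ (Ψ : Polynomial (PowerSeries L)) (y : PowerSeries K),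
      constantCoeff (Ψ.eval₂ (PowerSeries.map (algebraMap L K)) y) =
        (Ψ.map constantCoeff).eval₂ (algebraMap L K) (constantCoeff y) := by
    intro Ψ y
    rw [Polynomial.hom_eval₂, Polynomial.eval₂_map]
    congr 1
  intro s
  induction s using Nat.strong_induction_on with
  | _ s ih =>
  intro hs
  rcases Nat.eq_zero_or_pos s with rfl | hpos
  -- The reduction of `Φ` modulo `X` is nonzero because its derivative is, so its root
  -- `constantCoeff z` is algebraic over `L`.
  · refine hL _ ⟨Φ.map constantCoeff, ?_, ?_⟩
    · intro h0
      apply hd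
      rw [hcc, ← Polynomial.derivative_map, h0]
      simp
    · have h0 := PowerSeries.X_pow_dvd_iff.1 h 0 hs
      rw [coeff_zero_eq_constantCoeff_apply, hcc] at h0
      rwa [coeff_zero_eq_constantCoeff_apply]
  · have hlift : ∃ u : PowerSeries L, ∀ i < s, algebraMap L K (coeff i u) = coeff i z := by
      choose! f hf using fun i (hi : i < s) => ih i hi (hi.trans hs)
      exact ⟨PowerSeries.mk f, fun i hi => by rw [coeff_mk, hf i hi]⟩
    obtain ⟨u', hu'⟩ := hlift
    set u := PowerSeries.map (algebraMap L K) u' with hu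
    obtain ⟨v, hv⟩ : (X : PowerSeries K) ^ s ∣ z - u := by
      rw [PowerSeries.X_pow_dvd_iff]
      intro i hi
      rw [map_sub, hu, coeff_map, hu' i hi, sub_self]
    have hz : z = u + X ^ s * v := by rw [← hv]; ring
    have hcz : constantCoeff z = constantCoeff u := by
      rw [hz, map_add, map_mul, map_pow, constantCoeff_X, zero_pow hpos.ne', zero_mul, add_zero]
    -- Taylor expansion at `u`: since `s > 0`, the quadratic term does not reach the coefficient of
    -- `X ^ s`. What remains is a linear equation over `L` for `constantCoeff v`, with leading
    -- coefficient `c ≠ 0`.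
    obtain ⟨k, hk⟩ := Polynomial.binomExpansion
      (Φ.map (PowerSeries.map (algebraMap L K))) u (X ^ s * v)
    rw [← hz] at hk
    have hu0 : constantCoeff u = algebraMap L K (constantCoeff u') := by
      rw [hu, ← coeff_zero_eq_constantCoeff_apply, coeff_map, coeff_zero_eq_constantCoeff_apply]
    rw [hcc, hcz, hu0, Polynomial.eval₂_at_apply] at hd
    have hsq : (X ^ s * v) ^ 2 = X ^ s * (X ^ s * v ^ 2) := by ring
    have h1 := PowerSeries.X_pow_dvd_iff.1 h s hs
    rw [← Polynomial.eval_map, hk, Polynomial.eval_map, hsq, Polynomial.derivative_map,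
      Polynomial.eval_map, mul_left_comm, mul_left_comm k, map_add, map_add, hu,
      Polynomial.eval₂_at_apply, coeff_map] at h1
    have hXs : ∀ q : PowerSeries K, coeff s (X ^ s * q) = constantCoeff q := fun q => by
      simpa using PowerSeries.coeff_X_pow_mul q s 0
    rw [hXs, hXs, map_mul, map_mul, map_mul, map_pow constantCoeff X, constantCoeff_X,
      zero_pow hpos.ne', zero_mul, mul_zero, add_zero, ← hu, hcc, hu0,
      Polynomial.eval₂_at_apply] at h1
    set c := Polynomial.eval (constantCoeff u') (Φ.derivative.map constantCoeff)
    refine ⟨coeff s u' - coeff s (Φ.eval u') / c, ?_⟩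
    rw [hz, map_add, hXs, hu, coeff_map, map_sub, map_div₀]
    field_simp
    linear_combination -h1

/-! ### Rescaled arcs and `t`-adic estimates -/

namespace HypersurfaceJets

open PowerSeries in
/-- The polynomial `f(t^{α_1} x_1, …, t^{α_{n+1}} x_{n+1}) / t^w` with `w = min_{I ∈ A} α · I`. -/
noncomputable def weightedPoly {n : ℕ} (A : Support n) (a : A → ℂˣ) (α : Fin (n + 1) → ℕ) :
    MvPolynomial (Fin (n + 1)) (PowerSeries ℂ) :=
  ∑ I : A, MvPolynomial.monomial I.1 (C (a I : ℂ) * X ^ (dot α I.1 - minWeight A α))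

section

variable {n : ℕ} {A : Support n} {α : Fin (n + 1) → ℕ}

theorem minWeight_le {I : Fin (n + 1) →₀ ℕ} (hI : I ∈ A) : minWeight A α ≤ dot α I :=
  Nat.sInf_le ⟨I, hI, rfl⟩

theorem exists_dot_eq_minWeight (hA : A.Nonempty) : ∃ I ∈ A, dot α I = minWeight A α := by
  obtain ⟨I, hI⟩ := hA
  obtain ⟨J, hJ, h⟩ := Nat.sInf_mem (s := {k | ∃ I ∈ A, k = dot α I}) ⟨_, I, hI, rfl⟩
  exact ⟨J, hJ, h.symm⟩

theorem aeval_poly_X_pow_mul (a : A → ℂˣ) (y : Fin (n + 1) → PowerSeries ℂ) :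
    MvPolynomial.aeval (fun j => PowerSeries.X ^ α j * y j) (poly A a) =
      PowerSeries.X ^ minWeight A α * MvPolynomial.eval y (weightedPoly A a α) := by
  simp only [poly, weightedPoly, map_sum, Finset.mul_sum]
  refine Finset.sum_congr rfl fun I _ => ?_
  rw [MvPolynomial.aeval_monomial, MvPolynomial.eval_monomial, Finsupp.prod_fintype _ _ (by simp),
    Finsupp.prod_fintype _ _ (by simp)]
  simp only [mul_pow, Finset.prod_mul_distrib, ← pow_mul, Finset.prod_pow_eq_pow_sum]
  have h := Nat.add_sub_cancel' (minWeight_le (α := α) I.2)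
  have hd : ∑ j, α j * I.1 j = dot α I.1 := rfl
  rw [hd, ← h, pow_add, h]
  change PowerSeries.C _ * _ = _
  ring

theorem map_constantCoeff_weightedPoly (a : A → ℂˣ) :
    MvPolynomial.map PowerSeries.constantCoeff (weightedPoly A a α) = initialPoly A a α := by
  simp only [weightedPoly, initialPoly, map_sum, MvPolynomial.map_monomial, Finset.sum_filter]
  refine Finset.sum_congr rfl fun I _ => ?_
  split_ifs with h
  · simp [h]
  · have : dot α I.1 - minWeight A α ≠ 0 := by
      have := minWeight_le (α := α) I.2
      omega
    simp [this]

theorem constantCoeff_eval_weightedPoly (a : A → ℂˣ) (y : Fin (n + 1) → PowerSeries ℂ) :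
    PowerSeries.constantCoeff (MvPolynomial.eval y (weightedPoly A a α)) =
      MvPolynomial.eval (fun j => PowerSeries.constantCoeff (y j)) (initialPoly A a α) := by
  rw [← map_constantCoeff_weightedPoly, MvPolynomial.eval_map, MvPolynomial.eval,
    MvPolynomial.coe_eval₂Hom, MvPolynomial.hom_eval₂, RingHom.comp_id]

theorem eval_initialPoly_ne_zero (hA : A.Nonempty) (h : ¬ Feasible A α) (a : A → ℂˣ)
    {y : Fin (n + 1) → ℂ} (hy : ∀ j, y j ≠ 0) :
    MvPolynomial.eval y (initialPoly A a α) ≠ 0 := by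
  obtain ⟨I, hI, hw⟩ := exists_dot_eq_minWeight (α := α) hA
  have huniq : ∀ J : A, dot α J.1 = minWeight A α → J = ⟨I, hI⟩ := fun J hJ => by
    by_contra hne
    exact h ⟨I, hI, J.1, J.2, fun e => hne (Subtype.ext e.symm), hw, hJ⟩
  have : (Finset.univ.filter fun J : A => dot α J.1 = minWeight A α) = {⟨I, hI⟩} := by
    ext J
    simp only [Finset.mem_filter, Finset.mem_univ, true_and, Finset.mem_singleton]
    exact ⟨huniq J, fun e => e ▸ hw⟩
  rw [initialPoly, this, Finset.sum_singleton, MvPolynomial.eval_monomial]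
  exact mul_ne_zero (Units.ne_zero _) (Finset.prod_ne_zero_iff.2 fun j _ => pow_ne_zero _ (hy j))

theorem exists_eval_weightedPoly_eq_zero {a : A → ℂˣ} {m : ℕ} (hm : ∀ j, α j ≤ m) {p : Jet n m}
    (hp : p ∈ contactLocus (poly A a) m α) :
    ∃ y : Fin (n + 1) → PowerSeries ℂ, MvPolynomial.eval y (weightedPoly A a α) = 0 ∧
      (∀ j, PowerSeries.constantCoeff (y j) ≠ 0) ∧
      (∀ j (s : Fin (m + 1)), (s : ℕ) < α j → p (j, s) = 0) ∧
      ∀ j s (h : s + α j < m + 1), PowerSeries.coeff s (y j) = p (j, ⟨s + α j, h⟩) := by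
  obtain ⟨⟨γ, ⟨hγ, -⟩, rfl⟩, hc⟩ := hp
  have hord : ∀ j, (jetSeries (truncate m γ) j).order = α j := fun j =>
    (Set.mem_iInter.1 hc j).2
  have hcoeff : ∀ j s, s < m + 1 →
      PowerSeries.coeff s (jetSeries (truncate m γ) j) = PowerSeries.coeff s (γ j) := by
    intro j s hs
    simp only [jetSeries, truncate, PowerSeries.coeff_mk, dif_pos hs]
  have hlt : ∀ j s, s < α j → PowerSeries.coeff s (γ j) = 0 := by
    intro j s hs
    rw [← hcoeff j s (by have := hm j; omega)]
    exact PowerSeries.coeff_of_lt_order s (by rw [hord j]; exact_mod_cast hs)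
  choose y hy using fun j => PowerSeries.X_pow_dvd_iff.2 (hlt j)
  have hyc : ∀ j s, PowerSeries.coeff s (y j) = PowerSeries.coeff (s + α j) (γ j) := by
    intro j s
    rw [hy j, PowerSeries.coeff_X_pow_mul]
  refine ⟨y, ?_, fun j => ?_, fun j s hs => hlt j s hs, fun j s h => hyc j s⟩
  · have h0 : MvPolynomial.aeval γ (poly A a) = 0 := hγ
    rw [funext hy, aeval_poly_X_pow_mul] at h0
    exact (mul_eq_zero.1 h0).resolve_left (pow_ne_zero _ PowerSeries.X_ne_zero)
  · rw [← PowerSeries.coeff_zero_eq_constantCoeff_apply, hyc, zero_add,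
      ← hcoeff j _ (by have := hm j; omega)]
    exact ((PowerSeries.order_eq_nat).1 (hord j)).1

theorem contactLocus_eq_empty (hA : A.Nonempty) (h : ¬ Feasible A α) (a : A → ℂˣ) {m : ℕ}
    (hm : ∀ j, α j ≤ m) : contactLocus (poly A a) m α = ∅ := by
  refine Set.eq_empty_of_forall_notMem fun p hp => ?_
  obtain ⟨y, hy, hy0, -⟩ := exists_eval_weightedPoly_eq_zero hm hp
  apply eval_initialPoly_ne_zero hA h a hy0
  rw [← constantCoeff_eval_weightedPoly, hy, map_zero]

theorem prod_pow_sub_prod_pow_mem {R ι : Type*} [CommRing R] [Fintype ι] (J : Ideal R)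
    {x y : ι → R} {e : ι → ℕ} (h : ∀ j, 0 < e j → x j - y j ∈ J) :
    ∏ j, x j ^ e j - ∏ j, y j ^ e j ∈ J := by
  rw [← Ideal.Quotient.eq, map_prod, map_prod]
  refine Finset.prod_congr rfl fun j _ => ?_
  rcases Nat.eq_zero_or_pos (e j) with h0 | h0
  · simp [h0]
  · rw [map_pow, map_pow, Ideal.Quotient.eq.2 (h j h0)]

/-- The term of index `I` carries `t^{α·I-w}` and involves only the `y_j` with `I_j > 0`, so its
error has order at least `(α·I-w) + (m+1-α_j) ≥ N`. -/
theorem X_pow_dvd_eval_weightedPoly_sub {a : A → ℂˣ} {m μ N : ℕ}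
    (hμ : ∀ I ∈ A, ∀ j, 0 < I j → μ + α j ≤ dot α I) (hN : N + minWeight A α = m + 1 + μ)
    {y z : Fin (n + 1) → PowerSeries ℂ} (h : ∀ j, PowerSeries.X ^ (m + 1 - α j) ∣ y j - z j) :
    PowerSeries.X ^ N ∣
      MvPolynomial.eval y (weightedPoly A a α) - MvPolynomial.eval z (weightedPoly A a α) := by
  simp only [weightedPoly, map_sum, ← Finset.sum_sub_distrib]
  refine Finset.dvd_sum fun I _ => ?_
  have hw := minWeight_le (α := α) I.2
  rw [MvPolynomial.eval_monomial, MvPolynomial.eval_monomial, Finsupp.prod_fintype _ _ (by simp),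
    Finsupp.prod_fintype _ _ (by simp), ← mul_sub, mul_assoc]
  refine dvd_mul_of_dvd_right ?_ _
  have := prod_pow_sub_prod_pow_mem
    (Ideal.span {(PowerSeries.X : PowerSeries ℂ) ^ (N - (dot α I.1 - minWeight A α))})
    (x := y) (y := z) (e := I.1) fun j hj => by
      rw [Ideal.mem_span_singleton]
      refine (pow_dvd_pow _ ?_).trans (h j)
      have := hμ I.1 I.2 j hj
      omega
  rw [Ideal.mem_span_singleton] at this
  refine (pow_dvd_pow _ ?_).trans (pow_add (PowerSeries.X : PowerSeries ℂ) _ _ ▸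
    mul_dvd_mul_left (PowerSeries.X ^ (dot α I.1 - minWeight A α)) this)
  omega

/-- A nonzero derivative means that `x_j` occurs in a term of weight exactly `w`. This later gives
`N ≤ m+1-α_j`. -/
theorem le_minWeight_of_pderiv_ne_zero {a : A → ℂˣ} {μ : ℕ}
    (hμ : ∀ I ∈ A, ∀ j, 0 < I j → μ + α j ≤ dot α I) {j : Fin (n + 1)}
    (h : MvPolynomial.pderiv j (initialPoly A a α) ≠ 0) : μ + α j ≤ minWeight A α := by
  by_contra hlt
  apply h
  rw [initialPoly, map_sum]
  refine Finset.sum_eq_zero fun I hI => ?_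
  have hI' := (Finset.mem_filter.1 hI).2
  have : I.1 j = 0 := by
    by_contra h0
    have := hμ I.1 I.2 j (Nat.pos_of_ne_zero h0)
    omega
  rw [MvPolynomial.pderiv_monomial, this]
  simp

end

end HypersurfaceJets

/-! ### Reduction to one variable, components, and the universal jet -/

namespace HypersurfaceJets

theorem derivative_eval₂_eq_eval₂_pderiv {R S σ : Type*} [CommRing R] [CommRing S]
    [DecidableEq σ] (f : R →+* S) (c : σ → S) (i : σ) (P : MvPolynomial σ R) :
    Polynomial.derivative (P.eval₂ (Polynomial.C.comp f)
      fun j => if j = i then Polynomial.X else Polynomial.C (c j)) =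
    (MvPolynomial.pderiv i P).eval₂ (Polynomial.C.comp f)
      fun j => if j = i then Polynomial.X else Polynomial.C (c j) := by
  induction P using MvPolynomial.induction_on with
  | C r => simp
  | add P Q hP hQ => simp only [MvPolynomial.eval₂_add, map_add, hP, hQ]
  | mul_X P j hP =>
    rw [MvPolynomial.eval₂_mul, Polynomial.derivative_mul, hP, Derivation.leibniz,
      MvPolynomial.eval₂_add, smul_eq_mul, smul_eq_mul, MvPolynomial.eval₂_mul,
      MvPolynomial.eval₂_mul, MvPolynomial.eval₂_X, MvPolynomial.pderiv_X]
    rcases eq_or_ne j i with rfl | h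
    · simp only [if_true, Polynomial.derivative_X, Pi.single_eq_same, MvPolynomial.eval₂_one]
      ring
    · simp only [if_neg h, Polynomial.derivative_C, Pi.single_eq_of_ne h, MvPolynomial.eval₂_zero]
      ring

theorem coeff_mem_of_X_pow_dvd_eval₂ {k K σ : Type*} [Field k] [Field K] [Algebra k K]
    {L : IntermediateField k K} (hL : IsAlgClosedIn L K) (P : MvPolynomial σ (PowerSeries k))
    (y : σ → PowerSeries K) (i : σ) (hy : ∀ j, j ≠ i → ∀ s, PowerSeries.coeff s (y j) ∈ L) {N : ℕ}
    (h : PowerSeries.X ^ N ∣ P.eval₂ (PowerSeries.map (algebraMap k K)) y)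
    (hd : PowerSeries.constantCoeff
      ((MvPolynomial.pderiv i P).eval₂ (PowerSeries.map (algebraMap k K)) y) ≠ 0) :
    ∀ s < N, PowerSeries.coeff s (y i) ∈ L := by
  classical
  set f : PowerSeries k →+* PowerSeries L := PowerSeries.map (algebraMap k L)
  -- The value at `i` is a dummy: that variable becomes the polynomial indeterminate.
  set c' : σ → PowerSeries L := fun j =>
    if h : j = i then 0 else PowerSeries.mk fun s => ⟨PowerSeries.coeff s (y j), hy j h s⟩ with hc'
  set g : σ → Polynomial (PowerSeries L) :=
    fun j => if j = i then Polynomial.X else Polynomial.C (c' j) with hg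
  have key : ∀ Q : MvPolynomial σ (PowerSeries k),
      (Q.eval₂ (Polynomial.C.comp f) g).eval₂ (PowerSeries.map (algebraMap L K)) (y i) =
        Q.eval₂ (PowerSeries.map (algebraMap k K)) y := by
    intro Q
    rw [← Polynomial.coe_eval₂RingHom, MvPolynomial.hom_eval₂]
    congr 1
    · ext r s
      simp only [f, RingHom.comp_apply, Polynomial.coe_eval₂RingHom, Polynomial.eval₂_C,
        PowerSeries.coeff_map]
      rfl
    · funext j
      rcases eq_or_ne j i with rfl | hj
      · simp [hg]
      · ext s
        simp [hg, hc', hj]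
  intro s hs
  obtain ⟨b, hb⟩ := PowerSeries.coeff_mem_range_of_X_pow_dvd_eval₂ hL
    (P.eval₂ (Polynomial.C.comp f) g) (y i) N (by rwa [key])
    (by rwa [hg, derivative_eval₂_eq_eval₂_pderiv, ← hg, key]) s hs
  rw [← hb]
  exact b.2

/-- `S` is the finite union of the sets `S_i` where `h i ≠ 0`, so `p` is minimal over the ideal of
some `S_i`. Modulo that ideal `h i` is not a zero divisor, hence lies in no minimal prime. -/
theorem exists_notMem_of_mem_minimalPrimes_vanishingIdeal {σ ι : Type} [Finite ι]
    {S : Set (σ → ℂ)} {h : ι → MvPolynomial σ ℂ}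
    (hS : ∀ x ∈ S, ∃ i, MvPolynomial.aeval x (h i) ≠ 0) {p : Ideal (MvPolynomial σ ℂ)}
    (hp : p ∈ (MvPolynomial.vanishingIdeal ℂ S).minimalPrimes) : ∃ i, h i ∉ p := by
  classical
  have := Fintype.ofFinite ι
  set V : ι → Ideal (MvPolynomial σ ℂ) := fun i =>
    MvPolynomial.vanishingIdeal ℂ {x ∈ S | MvPolynomial.aeval x (h i) ≠ 0} with hV
  have hpp := hp.1.1
  have hle : Finset.univ.inf V ≤ p := by
    refine le_trans (fun f hf => ?_) hp.1.2
    rw [MvPolynomial.mem_vanishingIdeal_iff]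
    intro x hx
    obtain ⟨i, hi⟩ := hS x hx
    exact (Finset.inf_le (Finset.mem_univ i) : _ ≤ V i) hf x ⟨hx, hi⟩
  obtain ⟨i, -, hi⟩ := (Ideal.IsPrime.inf_le' hpp).1 hle
  refine ⟨i, fun hmem => ?_⟩
  have hmin : p ∈ (V i).minimalPrimes :=
    ⟨⟨hpp, hi⟩, fun q hq hqp => hp.2
      ⟨hq.1, (MvPolynomial.vanishingIdeal_anti_mono (Set.sep_subset _ _)).trans hq.2⟩ hqp⟩
  obtain ⟨y, hy, hxy⟩ := Ideal.exists_mul_mem_of_mem_minimalPrimes hmin hmem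
  refine hy fun x hx => ?_
  have := hxy x hx
  rw [map_mul] at this
  exact (mul_eq_zero.1 this).resolve_left hx.2

/-- The universal `m`-jet with order at least `α_j` along `x_j`, divided by `t^{α_j}`. -/
noncomputable def universalSeries {n : ℕ} (m : ℕ) (α : Fin (n + 1) → ℕ) (j : Fin (n + 1)) :
    PowerSeries (MvPolynomial (Fin (n + 1) × Fin (m + 1)) ℂ) :=
  PowerSeries.mk fun s =>
    if h : s + α j < m + 1 then MvPolynomial.X (j, ⟨s + α j, h⟩) else 0

theorem map_coeff_eval₂ {R σ B : Type*} [CommRing R] [CommRing B] [Algebra ℂ R] [Algebra ℂ B]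
    (φ : R →ₐ[ℂ] B) (P : MvPolynomial σ (PowerSeries ℂ)) (y : σ → PowerSeries R) (s : ℕ) :
    φ (PowerSeries.coeff s (P.eval₂ (PowerSeries.map (algebraMap ℂ R)) y)) =
      PowerSeries.coeff s (P.eval₂ (PowerSeries.map (algebraMap ℂ B))
        fun j => PowerSeries.map (φ : R →+* B) (y j)) := by
  have : P.eval₂ (PowerSeries.map (algebraMap ℂ B)) (fun j => PowerSeries.map (φ : R →+* B) (y j)) =
      PowerSeries.map (φ : R →+* B) (P.eval₂ (PowerSeries.map (algebraMap ℂ R)) y) := by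
    rw [MvPolynomial.hom_eval₂]
    congr 1
    ext r s
    simp
  rw [this, PowerSeries.coeff_map]
  rfl

/-! ### Equations of the contact locus and the dimension count -/

section

variable {n : ℕ} {A : Support n} {α : Fin (n + 1) → ℕ} {a : A → ℂˣ} {m μ N : ℕ}

theorem constantCoeff_eval₂_pderiv_weightedPoly {B : Type*} [CommRing B] [Algebra ℂ B]
    (i : Fin (n + 1)) (y : Fin (n + 1) → PowerSeries B) :
    PowerSeries.constantCoeff ((MvPolynomial.pderiv i (weightedPoly A a α)).eval₂
      (PowerSeries.map (algebraMap ℂ B)) y) =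
    MvPolynomial.aeval (fun j => PowerSeries.constantCoeff (y j))
      (MvPolynomial.pderiv i (initialPoly A a α)) := by
  rw [← map_constantCoeff_weightedPoly, MvPolynomial.pderiv_map, MvPolynomial.aeval_def,
    MvPolynomial.eval₂_map, MvPolynomial.hom_eval₂]
  congr 1

theorem coeff_eval₂_universalSeries_mem (hm : ∀ j, α j ≤ m)
    (hμ : ∀ I ∈ A, ∀ j, 0 < I j → μ + α j ≤ dot α I) (hN : N + minWeight A α = m + 1 + μ)
    {s : ℕ} (hs : s < N) :
    PowerSeries.coeff s ((weightedPoly A a α).eval₂ (PowerSeries.map (algebraMap ℂ _))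
      (universalSeries m α)) ∈
      MvPolynomial.vanishingIdeal ℂ (contactLocus (poly A a) m α) := by
  rw [MvPolynomial.mem_vanishingIdeal_iff]
  intro p hp
  obtain ⟨y, hy, -, -, hyp⟩ := exists_eval_weightedPoly_eq_zero hm hp
  rw [map_coeff_eval₂]
  set z : Fin (n + 1) → PowerSeries ℂ := fun j => PowerSeries.map
    ((MvPolynomial.aeval p : MvPolynomial (Fin (n + 1) × Fin (m + 1)) ℂ →ₐ[ℂ] ℂ) : _ →+* ℂ)
    (universalSeries m α j) with hz
  have h := X_pow_dvd_eval_weightedPoly_sub (a := a) hμ hN (y := y) (z := z) fun j => by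
    rw [PowerSeries.X_pow_dvd_iff]
    intro s hs
    have hs' : s + α j < m + 1 := by omega
    simp only [hz, universalSeries, map_sub, PowerSeries.coeff_map, PowerSeries.coeff_mk,
      hyp j s hs', dif_pos hs']
    simp
  rw [hy, zero_sub, dvd_neg] at h
  have := PowerSeries.X_pow_dvd_iff.1 h s hs
  rw [MvPolynomial.eval, MvPolynomial.coe_eval₂Hom] at this
  convert this using 3
  ext r s
  simp

/-- Coordinates of index below `α_j` vanish, and for `j = i` the next `N` are algebraic over the
rest by Newton iteration; `β` marks where the free coordinates begin. -/
theorem trdeg_quotient_le (hm : ∀ j, α j ≤ m)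
    (hμ : ∀ I ∈ A, ∀ j, 0 < I j → μ + α j ≤ dot α I) (hN : N + minWeight A α = m + 1 + μ)
    {p : Ideal (MvPolynomial (Fin (n + 1) × Fin (m + 1)) ℂ)} [p.IsPrime]
    (hp : MvPolynomial.vanishingIdeal ℂ (contactLocus (poly A a) m α) ≤ p) {i : Fin (n + 1)}
    (hi : MvPolynomial.aeval (fun j => MvPolynomial.X (j, ⟨α j, Nat.lt_succ_of_le (hm j)⟩))
      (MvPolynomial.pderiv i (initialPoly A a α)) ∉ p) {β : Fin (n + 1) → ℕ}
    (hβ : β = Function.update α i (α i + N)) :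
    Algebra.trdeg ℂ (MvPolynomial (Fin (n + 1) × Fin (m + 1)) ℂ ⧸ p) ≤
      (Finset.univ.filter fun q : Fin (n + 1) × Fin (m + 1) => β q.1 ≤ q.2).card := by
  set R := MvPolynomial (Fin (n + 1) × Fin (m + 1)) ℂ
  set K := FractionRing (R ⧸ p)
  set φ : R →ₐ[ℂ] K := (IsScalarTower.toAlgHom ℂ (R ⧸ p) K).comp (Ideal.Quotient.mkₐ ℂ p) with hφ
  have hφ0 : ∀ r, φ r = 0 ↔ r ∈ p := by
    intro r
    rw [← Ideal.Quotient.eq_zero_iff_mem]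
    exact map_eq_zero_iff (algebraMap (R ⧸ p) K) (IsFractionRing.injective _ _)
  refine trdeg_le_card_of_generators (K := K)
    (fun q => Ideal.Quotient.mk p (MvPolynomial.X q)) ?_ _ fun L hL hT => ?_
  · have := congrArg (Subalgebra.map (Ideal.Quotient.mkₐ ℂ p))
      (MvPolynomial.adjoin_range_X (R := ℂ) (σ := Fin (n + 1) × Fin (m + 1)))
    rw [AlgHom.map_adjoin, Algebra.map_top, (AlgHom.range_eq_top _).2
      (Ideal.Quotient.mkₐ_surjective ℂ p), ← Set.range_comp] at this
    exact this
  change ∀ q, φ (MvPolynomial.X q) ∈ L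
  replace hT : ∀ q : Fin (n + 1) × Fin (m + 1), β q.1 ≤ q.2 → φ (MvPolynomial.X q) ∈ L :=
    fun q hq => hT q (by simpa using hq)
  have hlow : ∀ j (s : Fin (m + 1)), (s : ℕ) < α j → φ (MvPolynomial.X (j, s)) ∈ L := by
    intro j s hs
    have : φ (MvPolynomial.X (j, s)) = 0 := by
      rw [hφ0]
      refine hp fun x hx => ?_
      obtain ⟨y, -, -, h, -⟩ := exists_eval_weightedPoly_eq_zero hm hx
      rw [MvPolynomial.aeval_X]
      exact h j s hs
    rw [this]
    exact L.zero_mem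
  set y : Fin (n + 1) → PowerSeries K :=
    fun j => PowerSeries.map (φ : R →+* K) (universalSeries m α j) with hy
  have hyc : ∀ j s, PowerSeries.coeff s (y j) =
      if h : s + α j < m + 1 then φ (MvPolynomial.X (j, ⟨s + α j, h⟩)) else 0 := by
    intro j s
    simp only [hy, universalSeries, PowerSeries.coeff_map, PowerSeries.coeff_mk]
    split_ifs
    · rfl
    · simp
  have hmem := coeff_mem_of_X_pow_dvd_eval₂ hL (weightedPoly A a α) y i (N := N) (by
      intro j hj s
      rw [hyc]
      split_ifs with h
      · exact hT _ (by simp [hβ, Function.update_of_ne hj])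
      · exact L.zero_mem) (by
      rw [PowerSeries.X_pow_dvd_iff]
      intro s hs
      rw [hy, ← map_coeff_eval₂, hφ0]
      exact hp (coeff_eval₂_universalSeries_mem hm hμ hN hs)) (by
      rw [constantCoeff_eval₂_pderiv_weightedPoly]
      have : (fun j => PowerSeries.constantCoeff (y j)) = fun j =>
          φ (MvPolynomial.X (j, ⟨α j, Nat.lt_succ_of_le (hm j)⟩)) := by
        funext j
        rw [← PowerSeries.coeff_zero_eq_constantCoeff_apply, hyc]
        simp [Nat.lt_succ_of_le (hm j)]
      rw [this]
      have h2 := MvPolynomial.comp_aeval_apply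
        (f := fun j => (MvPolynomial.X (j, ⟨α j, Nat.lt_succ_of_le (hm j)⟩) : R)) φ
        (MvPolynomial.pderiv i (initialPoly A a α))
      rw [← h2, Ne, hφ0]
      exact hi)
  rintro ⟨j, s⟩
  rcases lt_or_ge (s : ℕ) (α j) with h | h
  · exact hlow j s h
  rcases eq_or_ne j i with rfl | hj
  · rcases lt_or_ge (s : ℕ) (α j + N) with h' | h'
    · have := hmem (s - α j) (by omega)
      have hs : (s : ℕ) - α j + α j = s := Nat.sub_add_cancel h
      rw [hyc, dif_pos (by rw [hs]; exact s.2)] at this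
      simpa only [hs] using this
    · exact hT _ (by simpa [hβ] using h')
  · exact hT _ (by simpa [hβ, Function.update_of_ne hj] using h)

theorem card_filter_le_snd {β : Fin (n + 1) → ℕ} :
    (Finset.univ.filter fun q : Fin (n + 1) × Fin (m + 1) => β q.1 ≤ q.2).card =
      ∑ j, (m + 1 - β j) := by
  rw [Finset.card_filter, Fintype.sum_prod_type]
  refine Finset.sum_congr rfl fun j _ => ?_
  rw [← Finset.card_filter, ← Finset.card_map Fin.valEmbedding]
  have : (Finset.univ.filter fun s : Fin (m + 1) => β j ≤ s).map Fin.valEmbedding =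
      Finset.Ico (β j) (m + 1) := by
    ext s
    simp only [Finset.mem_map, Finset.mem_filter, Finset.mem_univ, true_and,
      Fin.valEmbedding_apply, Finset.mem_Ico]
    exact ⟨fun ⟨t, h, e⟩ => e ▸ ⟨h, t.2⟩, fun h => ⟨⟨s, h.2⟩, h.1, rfl⟩⟩
  rw [this, Nat.card_Ico]

theorem sum_sub_update_add {β : Fin (n + 1) → ℕ} {i : Fin (n + 1)} (hm : ∀ j, α j ≤ m)
    (hi : α i + N ≤ m + 1) (hβ : β = Function.update α i (α i + N)) :
    ((∑ j, (m + 1 - β j) : ℕ) : ℤ) = (n + 1) * m - ∑ j, ((α j : ℤ) - 1) - N := by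
  have hβm : ∀ j, β j ≤ m + 1 := by
    intro j
    rcases eq_or_ne j i with rfl | hj
    · simpa [hβ] using hi
    · rw [hβ, Function.update_of_ne hj]
      exact (hm j).trans (Nat.le_succ m)
  have hβ' : ∀ j, (β j : ℤ) = α j + if j = i then (N : ℤ) else 0 := by
    intro j
    rcases eq_or_ne j i with rfl | hj
    · simp [hβ]
    · simp [hβ, hj]
  rw [Nat.cast_sum, Finset.sum_congr rfl fun j _ => Nat.cast_sub (hβm j)]
  simp only [hβ', Finset.sum_sub_distrib, Finset.sum_add_distrib, Finset.sum_ite_eq',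
    Finset.mem_univ, if_true, Finset.sum_const, Finset.card_univ, Fintype.card_fin]
  simp
  ring

theorem zariskiDim_contactLocus_le (hα : ∀ j, α j ≤ m) (ha : a ∈ smoothCoeffs A α)
    (hμ : ∀ I ∈ A, ∀ j, 0 < I j → μ + α j ≤ dot α I) (hN : N + minWeight A α = m + 1 + μ)
    {r : ℕ} (hr : (r : ℤ) = (n + 1) * m - ∑ j, ((α j : ℤ) - 1) - N) :
    zariskiDim (contactLocus (poly A a) m α) ≤ r := by
  refine ringKrullDim_quotient_le_of_minimalPrimes fun p hp => ?_
  have := hp.1.1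
  obtain ⟨i, hi⟩ := exists_notMem_of_mem_minimalPrimes_vanishingIdeal
    (h := fun i => MvPolynomial.aeval
      (fun j => MvPolynomial.X (j, ⟨α j, Nat.lt_succ_of_le (hα j)⟩))
      (MvPolynomial.pderiv i (initialPoly A a α))) (fun x hx => by
      obtain ⟨y, hy, hy0, -, hyc⟩ := exists_eval_weightedPoly_eq_zero hα hx
      have hc : (fun j => x (j, ⟨α j, Nat.lt_succ_of_le (hα j)⟩)) =
          fun j => PowerSeries.constantCoeff (y j) := by
        funext j
        rw [← PowerSeries.coeff_zero_eq_constantCoeff_apply,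
          hyc j 0 (by have := hα j; omega)]
        simp
      by_contra! hall
      refine ha _ hy0 ⟨?_, fun i => ?_⟩
      · rw [← constantCoeff_eval_weightedPoly, hy, map_zero]
      · have := hall i
        rw [MvPolynomial.comp_aeval_apply] at this
        simp only [MvPolynomial.aeval_X] at this
        rw [hc] at this
        exact this) hp
  -- This ensures `α i + N ≤ m + 1`, so all `N` determined coefficients are actual jet coordinates
  -- and the natural subtractions in the count are exact.
  have hw := le_minWeight_of_pderiv_ne_zero (a := a) hμ (j := i) (by
    rintro h
    apply hi
    rw [h, map_zero]
    exact p.zero_mem)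
  have h := trdeg_quotient_le hα hμ hN hp.1.2 hi rfl
  rw [card_filter_le_snd] at h
  have hcard := sum_sub_update_add (N := N) (i := i) hα (by omega) rfl
  rw [← hr] at hcard
  exact ringKrullDim_le_of_trdeg_le (by rwa [Nat.cast_injective hcard] at h)

theorem le_dot {I : Fin (n + 1) →₀ ℕ} {j : Fin (n + 1)} (hj : 0 < I j) : α j ≤ dot α I :=
  (Nat.le_mul_of_pos_right _ hj).trans
    (Finset.single_le_sum (f := fun j => α j * I j) (fun _ _ => Nat.zero_le _) (Finset.mem_univ j))

theorem exists_minShiftedWeight_eq (hA : A.Nonempty) (h0 : (0 : Fin (n + 1) →₀ ℕ) ∉ A) :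
    ∃ μ : ℕ, minShiftedWeight A α = μ ∧ ∀ I ∈ A, ∀ j, 0 < I j → μ + α j ≤ dot α I := by
  have hbdd : BddBelow
      {k : ℤ | ∃ I ∈ A, ∃ j : Fin (n + 1), 0 < I j ∧ k = (dot α I : ℤ) - (α j : ℤ)} := by
    refine ⟨0, ?_⟩
    rintro _ ⟨I, -, j, hj, rfl⟩
    have := le_dot (α := α) hj
    omega
  have hne : {k : ℤ | ∃ I ∈ A, ∃ j : Fin (n + 1),
      0 < I j ∧ k = (dot α I : ℤ) - (α j : ℤ)}.Nonempty := by
    obtain ⟨I, hI⟩ := hA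
    obtain ⟨j, hj⟩ : ∃ j, I j ≠ 0 := by
      by_contra! h
      exact h0 ((Finsupp.ext h : I = 0) ▸ hI)
    exact ⟨_, I, hI, j, Nat.pos_of_ne_zero hj, rfl⟩
  obtain ⟨I, -, j, hj, h⟩ := Int.csInf_mem hne hbdd
  refine ⟨dot α I - α j, ?_, fun J hJ i hi => ?_⟩
  · rw [Nat.cast_sub (le_dot hj)]
    exact h
  · have h1 : minShiftedWeight A α ≤ (dot α J : ℤ) - (α i : ℤ) :=
      csInf_le hbdd ⟨J, hJ, i, hi, rfl⟩
    have h2 : minShiftedWeight A α = (dot α I : ℤ) - (α j : ℤ) := h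
    have := le_dot (α := α) hj
    omega

/-- On a line the only coordinate hyperplane is the origin, which `A` must avoid. -/
theorem IsIntegralSupport.ne_zero (hA : IsIntegralSupport A) : n ≠ 0 := by
  rintro rfl
  obtain ⟨I, hI, h⟩ := hA.meets_coordinate_planes 0
  refine hA.zero_notMem ((Finsupp.ext fun j => ?_ : I = 0) ▸ hI)
  rw [Fin.fin_one_eq_zero j, h, Finsupp.zero_apply]

end

end HypersurfaceJets

/-! ### Main theorem -/

theorem mainTheorem9 (n : ℕ) (A : HypersurfaceJets.Support n)
    (hA : HypersurfaceJets.IsIntegralSupport A)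
    (α : Fin (n + 1) → ℕ) (hα : ∀ j, 0 < α j) :
    (¬ HypersurfaceJets.Feasible A α →
      ∀ (a : A → ℂˣ) (m : ℕ), (∀ j, α j ≤ m) →
        HypersurfaceJets.contactLocus (HypersurfaceJets.poly A a) m α = ∅) ∧
    (HypersurfaceJets.Feasible A α →
      ∀ a ∈ HypersurfaceJets.smoothCoeffs A α ∩ HypersurfaceJets.primeCoeffs A,
        ∃ M : ℕ, ∀ m : ℕ, M ≤ m →
          ∃ r : ℕ,
            (r : ℤ) = (m : ℤ) * n - ∑ j, ((α j : ℤ) - 1) - 1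
              + (HypersurfaceJets.minWeight A α : ℤ)
              - HypersurfaceJets.minShiftedWeight A α ∧
            HypersurfaceJets.zariskiDim
              (HypersurfaceJets.contactLocus (HypersurfaceJets.poly A a) m α) ≤ (r : WithBot ℕ∞)) := by
  have hne : A.Nonempty := (hA.meets_coordinate_planes 0).imp fun _ h => h.1
  refine ⟨fun h a m hm => HypersurfaceJets.contactLocus_eq_empty hne h a hm, ?_⟩
  rintro - a ⟨ha, -⟩
  obtain ⟨μ, hμ, hμA⟩ :=
    HypersurfaceJets.exists_minShiftedWeight_eq (α := α) hne hA.zero_notMem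
  set w := HypersurfaceJets.minWeight A α with hw
  -- Large enough for `α j ≤ m`, for `w ≤ m + 1 + μ`, and, since `m ≤ m * n`, for the bound to be
  -- nonnegative.
  refine ⟨∑ j, α j + w + μ + 1, fun m hm => ?_⟩
  have hαm : ∀ j, α j ≤ m := fun j => by
    have := Finset.single_le_sum (f := α) (fun _ _ => Nat.zero_le _) (Finset.mem_univ j)
    omega
  have hsum : ∑ j, ((α j : ℤ) - 1) ≤ ((∑ j, α j : ℕ) : ℤ) := by
    rw [Nat.cast_sum]
    exact Finset.sum_le_sum fun j _ => by omega
  have hmn : (m : ℤ) ≤ m * n :=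
    le_mul_of_one_le_right (by positivity) (by exact_mod_cast Nat.one_le_iff_ne_zero.2 hA.ne_zero)
  obtain ⟨r, hr⟩ := Int.eq_ofNat_of_zero_le
    (a := (m : ℤ) * n - ∑ j, ((α j : ℤ) - 1) - 1 + (w : ℤ) - μ) (by omega)
  refine ⟨r, by rw [hμ, hr], HypersurfaceJets.zariskiDim_contactLocus_le hαm ha hμA
    (N := m + 1 + μ - w) (by omega) ?_⟩
  rw [← hr, Nat.cast_sub (by omega)]
  push_cast
  ring
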